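/- Let $N\ge 0$ and let $\hbar$ be a formal parameter. On $\mathbb{C}P^N$ use, in an affine chart with inhomogeneous coordinates $z=(z^1,\dots,z^N)\in\mathbb{C}^N$, the Fubini–Study Kähler potential $\Phi=\ln\bigl(1+\sum_k|z^k|^2\bigr)$, the metric $g_{k\bar l}=g_{\bar l k}=\partial_k\partial_{\bar l}\Phi$ with inverse $g^{\bar k l}=g^{l\bar k}$ (so $\sum_l g^{\bar k l}g_{l\bar m}=\delta_{km}$), and the operators $D^k=\sum_m g^{k\bar m}\partial_{\bar m}$, $D^{\bar l}=\sum_k g^{\bar l k}\partial_k$, $D^{\alpha}=\prod_k(D^k)^{\alpha_k}$, $D^{\beta^*}=\prod_l(D^{\bar l})^{\beta_l}$. Let $*$ be the star product with separation of variables on $\mathbb{C}P^N$ that Karabegov's construction attaches to the Fubini–Study Kähler form. That is, for every $f\in C^\infty(\mathbb{C}P^N)[[\hbar]]$ one has $f*g=L_f g$ with $L_f1=f$, where in each affine chart $L_f=\sum_{n\ge0}\hbar^nA_n$, each $A_n=\sum_\beta a_{n,\beta}D^{\beta^*}$ is a finite sum with smooth coefficients $a_{n,\beta}$ (depending on $f$),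 and $[L_f,\ \partial_{\bar l}\Phi+\hbar\,\partial_{\bar l}]=0$ for all $l$. Suppose that in some affine chart, for all $f,g\in C^\infty(\mathbb{C}P^N)$, $$f*g=\sum_{n=0}^\infty\ \sum_{|\alpha|=|\beta|=n}T^n_{\alpha,\beta}\,(D^{\alpha}f)\,(D^{\beta^*}g),$$ where the $T^n_{\alpha,\beta}$ are formal power series in $\hbar$ whose coefficients are smooth functions on the chart, independent of $f$ and $g$, where for each $k$ the coefficient of $\hbar^k$ in $T^n_{\alpha,\beta}$ vanishes identically for all $\alpha,\beta$ once $n$ is large enough (so that the sum over $n$ makes sense formally), and where $T^n_{\alpha,\beta}:=0$ if $\alpha\notin\mathbb{Z}_{\ge0}^N$ or $\beta\notin\mathbb{Z}_{\ge0}^N$. Then for all $n\ge1$, all $\alpha,\beta\in\mathbb{Z}^N$ with $\sum_k\alpha_k=\sum_k\beta_k=n$, and every $i\in\{1,\dots,N\}$ with $\beta_i\neq0$, $$T^n_{\alpha,\beta}=\sum_{d=1}^N\frac{\hbar\,g_{\bar i d}}{(1+\hbar-\hbar n)\,\beta_i}\,T^{n-1}_{\alpha-e_d,\,\beta-e_i}$$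 at every point of the chart. Here $e_k$ is the $k$-th standard basis vector, and the denominator, which has nonzero constant term $\beta_i$, is inverted in $\mathbb{C}[[\hbar]]$. -/

import Mathlib

open scoped ContDiff PowerSeries

noncomputable section

namespace KahlerStar

/-! Complex projective space, its affine charts and (formal) smooth functions. -/

/-- Complex projective space `ℂP^N`, the space of lines in `ℂ^{N+1}`. -/
abbrev CP (N : ℕ) : Type := Projectivization ℂ (Fin (N + 1) → ℂ)

/-- The coordinate space `ℂ^N`. -/
abbrev Coord (N : ℕ) : Type := Fin N → ℂ

/-- The homogeneous coordinates of the point with inhomogeneous coordinates `z` in the chart where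
the `j`-th homogeneous coordinate does not vanish: `1` is inserted at position `j`. -/
def homog {N : ℕ} (j : Fin (N + 1)) (z : Coord N) : Fin (N + 1) → ℂ :=
  j.insertNth (α := fun _ => ℂ) 1 z

theorem homog_ne_zero {N : ℕ} (j : Fin (N + 1)) (z : Coord N) : homog j z ≠ 0 := by
  intro h
  have h1 := congrFun h j
  simp [homog] at h1

/-- The inverse of the `j`-th affine chart: inhomogeneous coordinates to points of `ℂP^N`. -/
def affine {N : ℕ} (j : Fin (N + 1)) (z : Coord N) : CP N :=
  Projectivization.mk ℂ (homog j z) (homog_ne_zero j z)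

/-- `f ∈ C^∞(ℂP^N)`: the function is smooth (in the real sense) in each of the affine charts,
which together cover `ℂP^N`. -/
def IsSmooth {N : ℕ} (f : CP N → ℂ) : Prop :=
  ∀ j : Fin (N + 1), ContDiff ℝ ∞ (fun z : Coord N => f (affine j z))

/-- A formal power series `F = ∑ ħ^k F_k` of smooth functions on the coordinate space; the
formal parameter `ħ` is `PowerSeries.X`. -/
def IsFormalSmoothCoord {N : ℕ} (F : Coord N → ℂ⟦X⟧) : Prop :=
  ∀ k : ℕ, ContDiff ℝ ∞ (fun z => PowerSeries.coeff k (F z))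

/-- A formal power series `F = ∑ ħ^k F_k` of smooth functions on `ℂP^N`. -/
def IsFormalSmooth {N : ℕ} (F : CP N → ℂ⟦X⟧) : Prop :=
  ∀ k : ℕ, IsSmooth (fun p => PowerSeries.coeff k (F p))

/-! Kähler geometry in inhomogeneous coordinates. -/

/-- `∂_k = ∂/∂z^k = (∂/∂x^k - i ∂/∂y^k)/2`. -/
def dz {N : ℕ} (k : Fin N) (u : Coord N → ℂ) (z : Coord N) : ℂ :=
  (fderiv ℝ u z (Pi.single k 1) - Complex.I * fderiv ℝ u z (Pi.single k Complex.I)) / 2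

/-- `∂_{k̄} = ∂/∂z̄^k = (∂/∂x^k + i ∂/∂y^k)/2`. -/
def dzbar {N : ℕ} (k : Fin N) (u : Coord N → ℂ) (z : Coord N) : ℂ :=
  (fderiv ℝ u z (Pi.single k 1) + Complex.I * fderiv ℝ u z (Pi.single k Complex.I)) / 2

/-- The Fubini–Study Kähler potential `Φ = ln (1 + |z|²)`; it has this form in every affine
chart. -/
def potential {N : ℕ} (z : Coord N) : ℂ :=
  ((Real.log (1 + ∑ i, ‖z i‖ ^ 2) : ℝ) : ℂ)

/-- The metric `g_{k l̄} = ∂_k ∂_{l̄} Φ`, with row index `k` and column index `l`. -/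
def metric {N : ℕ} (z : Coord N) : Matrix (Fin N) (Fin N) ℂ :=
  Matrix.of fun k l => dz k (dzbar l potential) z

/-- The inverse metric `g^{k̄ l}`, with row index `k` and column index `l`, so that
`∑ l, g^{k̄ l} g_{l m̄} = δ_{k m}`. -/
def invMetric {N : ℕ} (z : Coord N) : Matrix (Fin N) (Fin N) ℂ :=
  (metric z)⁻¹

/-- `D^k = g^{k m̄} ∂_{m̄}`. -/
def Dhol {N : ℕ} (k : Fin N) (u : Coord N → ℂ) (z : Coord N) : ℂ :=
  ∑ m, invMetric z m k * dzbar m u z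

/-- `D^{l̄} = g^{l̄ k} ∂_k`. -/
def Dbar {N : ℕ} (l : Fin N) (u : Coord N → ℂ) (z : Coord N) : ℂ :=
  ∑ k, invMetric z l k * dz k u z

/-- `D^α = (D^1)^{α_1} ⋯ (D^N)^{α_N}`. -/
def DholPow {N : ℕ} (α : Fin N → ℕ) (u : Coord N → ℂ) : Coord N → ℂ :=
  (List.finRange N).foldr (fun k v => (Dhol k)^[α k] v) u

/-- `D^{β*} = (D^{1̄})^{β_1} ⋯ (D^{N̄})^{β_N}`. -/
def DbarPow {N : ℕ} (β : Fin N → ℕ) (u : Coord N → ℂ) : Coord N → ℂ :=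
  (List.finRange N).foldr (fun l v => (Dbar l)^[β l] v) u

/-! Formal differential operators and the star product. -/

/-- The operator `∑_n ħ^n A_n` with `A_n = ∑_β a_{n,β} D^{β*}` (a finite sum for each `n`), acting
`ħ`-linearly on formal power series of functions on the coordinate space. -/
def formalOp {N : ℕ} (a : ℕ → ((Fin N → ℕ) →₀ (Coord N → ℂ)))
    (F : Coord N → ℂ⟦X⟧) (z : Coord N) : ℂ⟦X⟧ :=
  PowerSeries.mk fun k => ∑ p ∈ Finset.HasAntidiagonal.antidiagonal k,
    (a p.1).sum fun β c => c z * DbarPow β (fun w => PowerSeries.coeff p.2 (F w)) z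

/-- The operator `R_{∂_{l̄} Φ} = ∂_{l̄} Φ + ħ ∂_{l̄}` on formal power series of functions. -/
def rightOp {N : ℕ} (l : Fin N) (F : Coord N → ℂ⟦X⟧) (z : Coord N) : ℂ⟦X⟧ :=
  PowerSeries.C (dzbar l potential z) * F z +
    PowerSeries.X * PowerSeries.mk fun k => dzbar l (fun w => PowerSeries.coeff k (F w)) z

/-- `star` is the star product with separation of variables on `ℂP^N` that Karabegov's
construction attaches to the Fubini–Study Kähler form: for every formal smooth `f`, left
multiplication `L_f = f * ·` satisfies `L_f 1 = f`, and in every affine chart it is given by a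
formal differential operator `∑_n ħ^n A_n`, `A_n = ∑_β a_{n,β} D^{β*}` with smooth `a_{n,β}`, which
commutes with `R_{∂_{l̄} Φ} = ∂_{l̄} Φ + ħ ∂_{l̄}` for all `l`. -/
structure IsKarabegovStar {N : ℕ}
    (star : (CP N → ℂ⟦X⟧) → (CP N → ℂ⟦X⟧) → (CP N → ℂ⟦X⟧)) : Prop where
  star_one : ∀ f, IsFormalSmooth f → star f 1 = f
  local_op : ∀ f, IsFormalSmooth f → ∀ j : Fin (N + 1),
    ∃ a : ℕ → ((Fin N → ℕ) →₀ (Coord N → ℂ)),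
      (∀ n β, ContDiff ℝ ∞ (a n β)) ∧
      (∀ g, IsFormalSmooth g → ∀ z : Coord N,
        star f g (affine j z) = formalOp a (fun w => g (affine j w)) z) ∧
      (∀ l : Fin N, ∀ F : Coord N → ℂ⟦X⟧, IsFormalSmoothCoord F →
        formalOp a (rightOp l F) = rightOp l (formalOp a F))

/-- A smooth function, seen as a formal power series that is constant in `ħ`. -/
def const {N : ℕ} (f : CP N → ℂ) (p : CP N) : ℂ⟦X⟧ := PowerSeries.C (f p)

/-- In the `j`-th affine chart the product `star` of smooth functions has the form
`f * g = ∑_n ∑_{|α| = |β| = n} T^n_{α β} (D^α f) (D^{β*} g)`, where the `T^n_{α β}` are formal power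
series in `ħ` of smooth functions and `T^n_{α β} = 0` unless `α` and `β` lie in `ℤ_{≥0}^N`.
For each power `ħ^k` only finitely many `n` contribute, so the sum over `n` is a formal one. -/
structure HasExpansion {N : ℕ}
    (star : (CP N → ℂ⟦X⟧) → (CP N → ℂ⟦X⟧) → (CP N → ℂ⟦X⟧)) (j : Fin (N + 1))
    (T : ℕ → (Fin N → ℤ) → (Fin N → ℤ) → Coord N → ℂ⟦X⟧) : Prop where
  smooth : ∀ n α β, IsFormalSmoothCoord (T n α β)
  eq_zero : ∀ n α β, ¬ (0 ≤ α ∧ 0 ≤ β) → T n α β = 0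
  expansion : ∀ k : ℕ, ∃ M : ℕ,
    (∀ n, M ≤ n → ∀ α β z, PowerSeries.coeff k (T n α β z) = 0) ∧
    ∀ f g : CP N → ℂ, IsSmooth f → IsSmooth g → ∀ z : Coord N,
      PowerSeries.coeff k (star (const f) (const g) (affine j z)) =
        ∑ n ∈ Finset.range M,
          ∑ α ∈ Finset.piAntidiag (Finset.univ : Finset (Fin N)) n,
            ∑ β ∈ Finset.piAntidiag (Finset.univ : Finset (Fin N)) n,
              PowerSeries.coeff k (T n (fun i => (α i : ℤ)) (fun i => (β i : ℤ)) z) *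
                DholPow α (fun w => f (affine j w)) z * DbarPow β (fun w => g (affine j w)) z

end KahlerStar

end

noncomputable section

namespace KahlerStar

/-! The proof tests the commutator with ∂_{ī}Φ + ħ∂_{ī} on functions adapted to the operators D. The
moments μ_l = ∂_{l̄}Φ = z^l/(1+|z|²) satisfy D^{l̄} μ_m = δ_{lm}, and their conjugates satisfy D^k
μ̄_m = δ_{km}. Hence D^{β*} and D^α act on polynomials in the μ_l, respectively the μ̄_l, as
ordinary iterated partial derivatives (`DbarPow_momentPoly`, `DholPow_conjMomentPoly`). Both
families extend to all of ℂP^N, because they come from Z_a Z̄_b/|Z|².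

Fix a point z₀ and |α| = r+1, |γ| = r. Let f be the monomial of exponent α in μ̄ - μ̄(z₀), and g the
monomial of exponent γ in μ - μ(z₀). Evaluate L_f(μ_i g + ħ∂_{ī}g) = (μ_i + ħ∂_{ī}) L_f g at z₀.
There D^α and D^{β*} read off Taylor coefficients, so the degree of f singles out n = r+1
(`opValue_center`).

On the left, μ_i g contributes α!(γ+e_i)! T^{r+1}_{α,γ+e_i}. Since ∂_{ī}μ_l = -μ_i μ_l, the
derivative ∂_{ī}g is -μ_i times an Euler operator applied to g, and contributes -r times the same
term. On the right, L_f g vanishes at z₀, and ∂_{ī} must fall on D^{α'}f to survive; as ∂_{ī}μ̄_d =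
g_{dī}, this gives α!γ! ∑_d g_{dī} T^r_{α-e_d,γ} (`dzbar_opValue_center`). Cancelling α!γ! leaves
(1-ħr)(γ_i+1)T^{r+1} = ħ∑_d g_{dī}T^r, which is the recursion. -/

variable {N : ℕ}

/-! ### Wirtinger derivatives of the coordinates. -/

/-- The linear functional `A ↦ (A(1) + s A(i)) / 2` on differentials, in the `k`-th coordinate
direction; for `s = ∓i` it turns the differential of a function into its derivative by `z^k`,
respectively `z̄^k`. -/
def wirtinger (s : ℂ) (k : Fin N) : (Coord N →L[ℝ] ℂ) →ₗ[ℂ] ℂ where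
  toFun A := (A (Pi.single k 1) + s * A (Pi.single k Complex.I)) / 2
  map_add' A B := by simp only [add_apply]; ring
  map_smul' c A := by simp only [smul_apply, smul_eq_mul, RingHom.id_apply]; ring

theorem dz_eq_wirtinger (k : Fin N) (u : Coord N → ℂ) (z : Coord N) :
    dz k u z = wirtinger (-Complex.I) k (fderiv ℝ u z) := by
  simp only [dz, wirtinger, LinearMap.coe_mk, AddHom.coe_mk]; ring

theorem dzbar_eq_wirtinger (k : Fin N) (u : Coord N → ℂ) (z : Coord N) :
    dzbar k u z = wirtinger Complex.I k (fderiv ℝ u z) := by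
  simp only [dzbar, wirtinger, LinearMap.coe_mk, AddHom.coe_mk]

theorem hasFDerivAt_coord (l : Fin N) (z : Coord N) :
    HasFDerivAt (fun w : Coord N => w l) (ContinuousLinearMap.proj (R := ℝ) (φ := fun _ : Fin N => ℂ) l) z :=
  (ContinuousLinearMap.proj (R := ℝ) (φ := fun _ : Fin N => ℂ) l).hasFDerivAt

theorem hasFDerivAt_conj_coord (l : Fin N) (z : Coord N) :
    HasFDerivAt (fun w : Coord N => (starRingEnd ℂ) (w l))
      ((Complex.conjCLE : ℂ →L[ℝ] ℂ).comp
        (ContinuousLinearMap.proj (R := ℝ) (φ := fun _ : Fin N => ℂ) l)) z :=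
  ((Complex.conjCLE : ℂ →L[ℝ] ℂ).comp
    (ContinuousLinearMap.proj (R := ℝ) (φ := fun _ : Fin N => ℂ) l)).hasFDerivAt

theorem wirtinger_coord (s : ℂ) (k l : Fin N) (z : Coord N) :
    wirtinger s k (fderiv ℝ (fun w : Coord N => w l) z) =
      if k = l then (1 + s * Complex.I) / 2 else 0 := by
  rw [(hasFDerivAt_coord l z).fderiv]
  by_cases h : k = l
  · subst h; simp [wirtinger]
  · simp [wirtinger, h]

theorem wirtinger_conj_coord (s : ℂ) (k l : Fin N) (z : Coord N) :
    wirtinger s k (fderiv ℝ (fun w : Coord N => (starRingEnd ℂ) (w l)) z) =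
      if k = l then (1 - s * Complex.I) / 2 else 0 := by
  rw [(hasFDerivAt_conj_coord l z).fderiv]
  by_cases h : k = l
  · subst h; simp [wirtinger]; ring
  · simp [wirtinger, h]

/-! ### The factor 1 + |z|² and the potential. -/

/-- `1 + |z|²`. -/
def normFactor (z : Coord N) : ℂ := 1 + ∑ i, z i * (starRingEnd ℂ) (z i)

theorem normFactor_eq_ofReal (z : Coord N) :
    normFactor z = ((1 + ∑ i, ‖z i‖ ^ 2 : ℝ) : ℂ) := by
  simp [normFactor, Complex.mul_conj, Complex.normSq_eq_norm_sq]

theorem one_add_norm_pos (z : Coord N) : 0 < 1 + ∑ i, ‖z i‖ ^ 2 := by positivity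

theorem normFactor_ne_zero (z : Coord N) : normFactor z ≠ 0 := by
  rw [normFactor_eq_ofReal]; exact_mod_cast (one_add_norm_pos z).ne'

theorem conj_normFactor (z : Coord N) : (starRingEnd ℂ) (normFactor z) = normFactor z := by
  rw [normFactor_eq_ofReal, Complex.conj_ofReal]

theorem contDiff_coord (l : Fin N) : ContDiff ℝ ∞ (fun w : Coord N => w l) :=
  contDiff_apply ℝ ℂ l

theorem contDiff_conj_coord (l : Fin N) :
    ContDiff ℝ ∞ (fun w : Coord N => (starRingEnd ℂ) (w l)) :=
  (Complex.conjCLE : ℂ →L[ℝ] ℂ).contDiff.comp (contDiff_coord l)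

theorem contDiff_normFactor : ContDiff ℝ ∞ (normFactor (N := N)) :=
  contDiff_const.add (ContDiff.sum fun i _ => (contDiff_coord i).mul (contDiff_conj_coord i))

theorem contDiff_potential : ContDiff ℝ ∞ (potential (N := N)) := by
  have h : ContDiff ℝ ∞ (fun z : Coord N => Real.log (1 + ∑ i, ‖z i‖ ^ 2)) := by
    refine ContDiff.log (contDiff_const.add (ContDiff.sum fun i _ => ?_))
      fun z => (one_add_norm_pos z).ne'
    exact (contDiff_coord i).norm_sq ℝ
  exact Complex.ofRealCLM.contDiff.comp h

theorem fderiv_normFactor (z : Coord N) :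
    fderiv ℝ (normFactor (N := N)) z =
      ∑ i, (z i • fderiv ℝ (fun w : Coord N => (starRingEnd ℂ) (w i)) z +
        (starRingEnd ℂ) (z i) • fderiv ℝ (fun w : Coord N => w i) z) := by
  have h := HasFDerivAt.const_add (1 : ℂ) (HasFDerivAt.fun_sum (u := Finset.univ) fun (i : Fin N) _ =>
    (hasFDerivAt_coord i z).mul (hasFDerivAt_conj_coord i z))
  simp only [(hasFDerivAt_coord _ z).fderiv, (hasFDerivAt_conj_coord _ z).fderiv]
  exact h.fderiv

theorem dz_normFactor (k : Fin N) (z : Coord N) :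
    dz k normFactor z = (starRingEnd ℂ) (z k) := by
  rw [dz_eq_wirtinger, fderiv_normFactor]
  simp [wirtinger_coord, wirtinger_conj_coord]

theorem dzbar_normFactor (k : Fin N) (z : Coord N) : dzbar k normFactor z = z k := by
  rw [dzbar_eq_wirtinger, fderiv_normFactor]
  simp [wirtinger_coord, wirtinger_conj_coord]

/-- Differentiating e^Φ instead of Φ yields ∂_{l̄}Φ without handling the real logarithm. -/
theorem exp_potential (z : Coord N) : Complex.exp (potential z) = normFactor z := by
  rw [potential, ← Complex.ofReal_exp, Real.exp_log (one_add_norm_pos z), normFactor_eq_ofReal]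

theorem dzbar_potential (l : Fin N) (z : Coord N) :
    dzbar l potential z = z l / normFactor z := by
  have hd : HasFDerivAt (potential (N := N)) (fderiv ℝ potential z) z :=
    (contDiff_potential.differentiable (by simp) z).hasFDerivAt
  have h := hd.cexp
  simp only [exp_potential] at h
  have h2 : fderiv ℝ (normFactor (N := N)) z = _ := h.fderiv
  have h3 := dzbar_normFactor l z
  rw [dzbar_eq_wirtinger, h2, map_smul, smul_eq_mul] at h3
  rw [dzbar_eq_wirtinger, eq_div_iff (normFactor_ne_zero z), mul_comm, h3]

/-! ### Moments, the Hermitian metric and duality with the operators D. -/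

/-- The function `z^l / (1 + |z|²)`, which is `∂_{l̄} Φ`. -/
def moment (l : Fin N) (z : Coord N) : ℂ := z l / normFactor z

theorem dzbar_potential_eq_moment (l : Fin N) :
    dzbar l (potential (N := N)) = moment l :=
  funext fun z => dzbar_potential l z

theorem moment_mul_normFactor (l : Fin N) (z : Coord N) : moment l z * normFactor z = z l :=
  div_mul_cancel₀ _ (normFactor_ne_zero z)

theorem contDiff_moment (l : Fin N) : ContDiff ℝ ∞ (moment (N := N) l) := by
  have h := (contDiff_coord l).mul (contDiff_normFactor.inv normFactor_ne_zero)
  rwa [show moment (N := N) l = fun z => z l * normFactor⁻¹ z from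
    funext fun z => div_eq_mul_inv _ _]

theorem contDiff_conj_moment (l : Fin N) :
    ContDiff ℝ ∞ (fun z : Coord N => (starRingEnd ℂ) (moment l z)) :=
  (Complex.conjCLE : ℂ →L[ℝ] ℂ).contDiff.comp (contDiff_moment l)

/-- The Leibniz rule for `moment l * normFactor` = z^l, solved for the derivative of the moment. -/
theorem wirtinger_moment (s : ℂ) (k l : Fin N) (z : Coord N) :
    wirtinger s k (fderiv ℝ (moment l) z) =
      (wirtinger s k (fderiv ℝ (fun w : Coord N => w l) z) -
        moment l z * wirtinger s k (fderiv ℝ normFactor z)) / normFactor z := by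
  have h := fderiv_fun_mul ((contDiff_moment l).differentiable (by simp) z)
    (contDiff_normFactor.differentiable (by simp) z)
  simp only [moment_mul_normFactor] at h
  rw [h, eq_div_iff (normFactor_ne_zero z)]
  simp only [map_add, map_smul, smul_eq_mul]
  ring

/-- This quadratic law is the source of the term -ħr in the denominator of the recursion. -/
theorem dzbar_moment (k l : Fin N) (z : Coord N) :
    dzbar k (moment l) z = -(moment k z * moment l z) := by
  rw [dzbar_eq_wirtinger, wirtinger_moment, ← dzbar_eq_wirtinger, ← dzbar_eq_wirtinger,
    dzbar_normFactor, dzbar_eq_wirtinger, wirtinger_coord]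
  simp only [Complex.I_mul_I, moment]
  split_ifs <;> ring

theorem dz_moment (k l : Fin N) (z : Coord N) :
    dz k (moment l) z =
      ((if k = l then 1 else 0) - moment l z * (starRingEnd ℂ) (z k)) / normFactor z := by
  rw [dz_eq_wirtinger, wirtinger_moment, ← dz_eq_wirtinger, ← dz_eq_wirtinger, dz_normFactor,
    dz_eq_wirtinger, wirtinger_coord]
  simp

theorem metric_apply (k l : Fin N) (z : Coord N) : metric z k l = dz k (moment l) z := by
  rw [metric, Matrix.of_apply, dzbar_potential_eq_moment]

theorem dzbar_conj_moment (k l : Fin N) (z : Coord N) :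
    dzbar k (fun w => (starRingEnd ℂ) (moment l w)) z = (starRingEnd ℂ) (dz k (moment l) z) := by
  have h := ((Complex.conjCLE : ℂ →L[ℝ] ℂ).hasFDerivAt (x := moment l z)).comp z
    ((contDiff_moment l).differentiable (by simp) z).hasFDerivAt
  have h2 : fderiv ℝ (fun w => (starRingEnd ℂ) (moment l w)) z = _ := h.fderiv
  simp [dzbar, dz, h2, map_ofNat]

theorem conj_metric (k l : Fin N) (z : Coord N) :
    (starRingEnd ℂ) (metric z k l) = metric z l k := by
  rw [metric_apply, metric_apply, dz_moment, dz_moment, map_div₀, conj_normFactor]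
  simp only [map_sub, map_mul, moment, map_div₀, conj_normFactor, Complex.conj_conj,
    apply_ite (starRingEnd ℂ), map_one, map_zero, eq_comm (a := k)]
  ring

/-- Conjugation exchanges ∂_k and ∂_{k̄}; Hermitian symmetry of the metric then swaps the indices.
-/
theorem dzbar_conj_moment_eq_metric (k l : Fin N) (z : Coord N) :
    dzbar k (fun w => (starRingEnd ℂ) (moment l w)) z = metric z l k := by
  rw [dzbar_conj_moment, ← metric_apply, conj_metric]

/-- The metric is a rank-one perturbation of a scalar matrix, so Sherman–Morrison gives its inverse.
Only invertibility is needed later. -/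
theorem metric_mul_explicit (z : Coord N) :
    metric z * Matrix.of (fun l m : Fin N =>
      normFactor z * ((if l = m then 1 else 0) + (starRingEnd ℂ) (z l) * z m)) = 1 := by
  ext k m
  have hc := normFactor_ne_zero z
  have hS : ∑ l, z l * (starRingEnd ℂ) (z l) = normFactor z - 1 := by simp [normFactor]
  rw [Matrix.mul_apply]
  have : ∀ l, metric z k l * (normFactor z * ((if l = m then 1 else 0) +
      (starRingEnd ℂ) (z l) * z m)) =
      (if k = l then (if l = m then 1 else 0) + (starRingEnd ℂ) (z l) * z m else 0) -
      (if l = m then (starRingEnd ℂ) (z k) * z l / normFactor z else 0) -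
      (starRingEnd ℂ) (z k) * z m / normFactor z * (z l * (starRingEnd ℂ) (z l)) := by
    intro l
    rw [metric_apply, dz_moment, moment]
    split_ifs <;> field_simp <;> ring
  simp only [Matrix.of_apply, this, Finset.sum_sub_distrib, ← Finset.mul_sum, hS,
    Finset.sum_ite_eq, Finset.sum_ite_eq', Finset.mem_univ, if_true, Matrix.one_apply]
  field_simp
  ring

theorem isUnit_det_metric (z : Coord N) : IsUnit (metric z).det := by
  rw [← Matrix.isUnit_iff_isUnit_det]
  exact IsUnit.of_mul_eq_one _ (metric_mul_explicit z)

/-- The metric is the matrix of the ∂_k μ_m, and D^{l̄} contracts it with its inverse. -/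
theorem Dbar_moment (l m : Fin N) (z : Coord N) :
    Dbar l (moment m) z = if l = m then 1 else 0 := by
  have h := congrFun (congrFun (Matrix.nonsing_inv_mul _ (isUnit_det_metric z)) l) m
  rw [Matrix.mul_apply, Matrix.one_apply] at h
  rw [Dbar, ← h]
  simp only [metric_apply, invMetric]

theorem Dhol_conj_moment (k m : Fin N) (z : Coord N) :
    Dhol k (fun w => (starRingEnd ℂ) (moment m w)) z = if m = k then 1 else 0 := by
  have h := congrFun (congrFun (Matrix.mul_nonsing_inv _ (isUnit_det_metric z)) m) k
  rw [Matrix.mul_apply, Matrix.one_apply] at h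
  rw [Dhol, ← h]
  exact Finset.sum_congr rfl fun l _ => by
    rw [dzbar_conj_moment_eq_metric, invMetric, mul_comm]

/-! Polynomials in the moment functions and in their conjugates. -/

theorem contDiff_eval {E : Type*} [NormedAddCommGroup E] [NormedSpace ℝ E] {h : Fin N → E → ℂ}
    (hh : ∀ k, ContDiff ℝ ∞ (h k)) (p : MvPolynomial (Fin N) ℂ) :
    ContDiff ℝ ∞ (fun w => MvPolynomial.eval (fun l => h l w) p) := by
  induction p using MvPolynomial.induction_on with
  | C a => simpa using contDiff_const
  | add p q hp hq => simpa only [map_add] using hp.add hq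
  | mul_X p i hp => simpa only [map_mul, MvPolynomial.eval_X] using hp.mul (hh i)

theorem fderiv_eval {h : Fin N → Coord N → ℂ} (hh : ∀ k, ContDiff ℝ ∞ (h k))
    (p : MvPolynomial (Fin N) ℂ) (z v : Coord N) :
    fderiv ℝ (fun w => MvPolynomial.eval (fun l => h l w) p) z v =
      ∑ k, MvPolynomial.eval (fun l => h l z) (MvPolynomial.pderiv k p) * fderiv ℝ (h k) z v := by
  have hd (q : MvPolynomial (Fin N) ℂ) :
      DifferentiableAt ℝ (fun w => MvPolynomial.eval (fun l => h l w) q) z :=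
    (contDiff_eval hh q).differentiable (by simp) z
  induction p using MvPolynomial.induction_on with
  | C a => simp
  | add p q hp hq =>
    simp only [map_add, fderiv_fun_add (hd p) (hd q), add_apply, hp, hq, add_mul,
      Finset.sum_add_distrib]
  | mul_X p i hp =>
    have h1 := fderiv_fun_mul (hd p) ((hh i).differentiable (by simp) z)
    simp only [map_mul, MvPolynomial.eval_X, h1, add_apply, smul_apply, smul_eq_mul, hp,
      MvPolynomial.pderiv_mul, map_add, MvPolynomial.pderiv_X, Pi.single_apply, add_mul,
      Finset.sum_add_distrib, Finset.mul_sum]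
    rw [add_comm]
    congr 1
    · exact Finset.sum_congr rfl fun k _ => by ring
    · rw [Finset.sum_eq_single i]
      · simp
      · intro b _ hb
        simp [Ne.symm hb]
      · simp

/-- The polynomial `p` in the functions `z^l / (1 + |z|²) - u_l`. -/
def momentPoly (u : Fin N → ℂ) (p : MvPolynomial (Fin N) ℂ) (z : Coord N) : ℂ :=
  MvPolynomial.eval (fun l => moment l z - u l) p

/-- The polynomial `q` in the functions `z̄^l / (1 + |z|²) - v_l`. -/
def conjMomentPoly (v : Fin N → ℂ) (q : MvPolynomial (Fin N) ℂ) (z : Coord N) : ℂ :=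
  MvPolynomial.eval (fun l => (starRingEnd ℂ) (moment l z) - v l) q

theorem contDiff_momentPoly (u : Fin N → ℂ) (p : MvPolynomial (Fin N) ℂ) :
    ContDiff ℝ ∞ (momentPoly u p) :=
  contDiff_eval (fun k => (contDiff_moment k).sub contDiff_const) p

theorem contDiff_conjMomentPoly (v : Fin N → ℂ) (q : MvPolynomial (Fin N) ℂ) :
    ContDiff ℝ ∞ (conjMomentPoly v q) :=
  contDiff_eval (fun k => (contDiff_conj_moment k).sub contDiff_const) q

theorem wirtinger_momentPoly (s : ℂ) (k : Fin N) (u : Fin N → ℂ) (p : MvPolynomial (Fin N) ℂ)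
    (z : Coord N) :
    wirtinger s k (fderiv ℝ (momentPoly u p) z) =
      ∑ m, momentPoly u (MvPolynomial.pderiv m p) z * wirtinger s k (fderiv ℝ (moment m) z) := by
  have h : ∀ e, fderiv ℝ (momentPoly u p) z e = _ :=
    fderiv_eval (h := fun l w => moment l w - u l)
      (fun k => (contDiff_moment k).sub contDiff_const) p z
  simp only [wirtinger, LinearMap.coe_mk, AddHom.coe_mk, h, fderiv_sub_const, momentPoly,
    Finset.mul_sum, ← Finset.sum_add_distrib, Finset.sum_div]
  exact Finset.sum_congr rfl fun k _ => by ring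

theorem wirtinger_conjMomentPoly (s : ℂ) (k : Fin N) (v : Fin N → ℂ)
    (q : MvPolynomial (Fin N) ℂ) (z : Coord N) :
    wirtinger s k (fderiv ℝ (conjMomentPoly v q) z) =
      ∑ m, conjMomentPoly v (MvPolynomial.pderiv m q) z *
        wirtinger s k (fderiv ℝ (fun w => (starRingEnd ℂ) (moment m w)) z) := by
  have h : ∀ e, fderiv ℝ (conjMomentPoly v q) z e = _ :=
    fderiv_eval (h := fun l w => (starRingEnd ℂ) (moment l w) - v l)
      (fun k => (contDiff_conj_moment k).sub contDiff_const) q z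
  simp only [wirtinger, LinearMap.coe_mk, AddHom.coe_mk, h, fderiv_sub_const, conjMomentPoly,
    Finset.mul_sum, ← Finset.sum_add_distrib, Finset.sum_div]
  exact Finset.sum_congr rfl fun k _ => by ring

theorem Dbar_momentPoly (l : Fin N) (u : Fin N → ℂ) (p : MvPolynomial (Fin N) ℂ) :
    Dbar l (momentPoly u p) = momentPoly u (MvPolynomial.pderiv l p) := by
  funext z
  simp only [Dbar, dz_eq_wirtinger, wirtinger_momentPoly]
  simp only [← dz_eq_wirtinger, Finset.mul_sum]
  rw [Finset.sum_comm]
  have : ∀ m, ∑ k, invMetric z l k * (momentPoly u (MvPolynomial.pderiv m p) z * dz k (moment m) z)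
      = momentPoly u (MvPolynomial.pderiv m p) z * Dbar l (moment m) z := by
    intro m
    rw [Dbar, Finset.mul_sum]
    exact Finset.sum_congr rfl fun k _ => by ring
  simp [this, Dbar_moment]

theorem Dhol_conjMomentPoly (l : Fin N) (v : Fin N → ℂ) (q : MvPolynomial (Fin N) ℂ) :
    Dhol l (conjMomentPoly v q) = conjMomentPoly v (MvPolynomial.pderiv l q) := by
  funext z
  simp only [Dhol, dzbar_eq_wirtinger, wirtinger_conjMomentPoly]
  simp only [← dzbar_eq_wirtinger, Finset.mul_sum]
  rw [Finset.sum_comm]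
  have : ∀ m, ∑ k, invMetric z k l * (conjMomentPoly v (MvPolynomial.pderiv m q) z *
      dzbar k (fun w => (starRingEnd ℂ) (moment m w)) z)
      = conjMomentPoly v (MvPolynomial.pderiv m q) z *
        Dhol l (fun w => (starRingEnd ℂ) (moment m w)) z := by
    intro m
    rw [Dhol, Finset.mul_sum]
    exact Finset.sum_congr rfl fun k _ => by ring
  simp [this, Dhol_conj_moment]

open MvPolynomial in
/-- The polynomial that represents `∂_{m̄}` of a polynomial in the moment functions. -/
def dzbarPoly (u : Fin N → ℂ) (m : Fin N) (p : MvPolynomial (Fin N) ℂ) :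
    MvPolynomial (Fin N) ℂ :=
  -((X m + C (u m)) * ∑ k, (X k + C (u k)) * pderiv k p)

/-- The chain rule with `dzbar_moment`. The centre `u` stays constant while the point varies, so X_m
+ C(u_m) stands for the unshifted moment. -/
theorem dzbar_momentPoly (m : Fin N) (u : Fin N → ℂ) (p : MvPolynomial (Fin N) ℂ) :
    dzbar m (momentPoly u p) = momentPoly u (dzbarPoly u m p) := by
  funext z
  rw [dzbar_eq_wirtinger, wirtinger_momentPoly]
  simp only [← dzbar_eq_wirtinger, dzbar_moment]
  simp only [momentPoly, dzbarPoly, map_neg, map_mul, map_add, map_sum, MvPolynomial.eval_X,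
    MvPolynomial.eval_C, sub_add_cancel, Finset.mul_sum, ← Finset.sum_neg_distrib]
  exact Finset.sum_congr rfl fun k _ => by ring

theorem moment_mul_momentPoly (m : Fin N) (u : Fin N → ℂ) (p : MvPolynomial (Fin N) ℂ)
    (z : Coord N) :
    moment m z * momentPoly u p z =
      momentPoly u ((MvPolynomial.X m + MvPolynomial.C (u m)) * p) z := by
  simp [momentPoly]

/-- The only place where the metric enters the recursion. -/
theorem dzbar_conjMomentPoly (m : Fin N) (v : Fin N → ℂ) (q : MvPolynomial (Fin N) ℂ)
    (z : Coord N) :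
    dzbar m (conjMomentPoly v q) z =
      ∑ d, conjMomentPoly v (MvPolynomial.pderiv d q) z * metric z d m := by
  rw [dzbar_eq_wirtinger, wirtinger_conjMomentPoly]
  simp only [← dzbar_eq_wirtinger, dzbar_conj_moment_eq_metric]

/-! Iterated derivatives. -/

/-- The iterated partial derivative of a polynomial along the coordinates in the list `L`. -/
def multiDeriv (α : Fin N → ℕ) (L : List (Fin N)) (p : MvPolynomial (Fin N) ℂ) :
    MvPolynomial (Fin N) ℂ :=
  L.foldr (fun k v => (MvPolynomial.pderiv k)^[α k] v) p

theorem DbarPow_momentPoly (β : Fin N → ℕ) (u : Fin N → ℂ) (p : MvPolynomial (Fin N) ℂ) :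
    DbarPow β (momentPoly u p) = momentPoly u (multiDeriv β (List.finRange N) p) := by
  rw [DbarPow, multiDeriv]
  induction List.finRange N with
  | nil => rfl
  | cons k L ih =>
    rw [List.foldr_cons, List.foldr_cons, ih]
    exact ((Function.Semiconj.iterate_right (f := momentPoly u)
      (fun q => (Dbar_momentPoly k u q).symm) (β k)) _).symm

theorem DholPow_conjMomentPoly (α : Fin N → ℕ) (v : Fin N → ℂ) (q : MvPolynomial (Fin N) ℂ) :
    DholPow α (conjMomentPoly v q) = conjMomentPoly v (multiDeriv α (List.finRange N) q) := by
  rw [DholPow, multiDeriv]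
  induction List.finRange N with
  | nil => rfl
  | cons k L ih =>
    rw [List.foldr_cons, List.foldr_cons, ih]
    exact ((Function.Semiconj.iterate_right (f := conjMomentPoly v)
      (fun q => (Dhol_conjMomentPoly k v q).symm) (α k)) _).symm

theorem pderiv_commute (d k : Fin N) (p : MvPolynomial (Fin N) ℂ) :
    MvPolynomial.pderiv d (MvPolynomial.pderiv k p) =
      MvPolynomial.pderiv k (MvPolynomial.pderiv d p) := by
  by_cases h : d = k
  · rw [h]
  · ext m
    simp only [MvPolynomial.coeff_pderiv, Finsupp.add_apply, Finsupp.single_apply, h, Ne.symm h,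
      if_false, add_zero]
    rw [add_right_comm]
    ring

theorem pderiv_multiDeriv (d : Fin N) (α : Fin N → ℕ) (L : List (Fin N))
    (p : MvPolynomial (Fin N) ℂ) :
    MvPolynomial.pderiv d (multiDeriv α L p) = multiDeriv α L (MvPolynomial.pderiv d p) := by
  induction L with
  | nil => rfl
  | cons k L ih =>
    simp only [multiDeriv, List.foldr_cons] at ih ⊢
    rw [← ih]
    exact Function.Commute.iterate_right (f := MvPolynomial.pderiv (R := ℂ) d)
      (fun q => pderiv_commute d k q) (α k) _

/-- An exponent zero in direction k turns the product of the derivative factors into a full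
factorial. -/
theorem coeff_iterate_pderiv (k : Fin N) (a : ℕ) (p : MvPolynomial (Fin N) ℂ) (m : Fin N →₀ ℕ)
    (hm : m k = 0) :
    MvPolynomial.coeff m ((MvPolynomial.pderiv k)^[a] p) =
      MvPolynomial.coeff (m + Finsupp.single k a) p * a.factorial := by
  induction a generalizing p with
  | zero => simp
  | succ a ih =>
    rw [Function.iterate_succ_apply, ih, MvPolynomial.coeff_pderiv, add_assoc,
      ← Finsupp.single_add]
    simp [hm, Nat.factorial_succ]
    ring

theorem coeff_multiDeriv (α : Fin N → ℕ) (L : List (Fin N)) (hL : L.Nodup)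
    (p : MvPolynomial (Fin N) ℂ) (m : Fin N →₀ ℕ) (hm : ∀ k ∈ L, m k = 0) :
    MvPolynomial.coeff m (multiDeriv α L p) =
      MvPolynomial.coeff (m + (L.map fun k => Finsupp.single k (α k)).sum) p *
        ((L.map fun k => (α k).factorial).prod : ℕ) := by
  induction L generalizing m with
  | nil => simp [multiDeriv]
  | cons k L ih =>
    rw [List.nodup_cons] at hL
    have h1 : multiDeriv α (k :: L) p = (MvPolynomial.pderiv k)^[α k] (multiDeriv α L p) := rfl
    rw [h1, coeff_iterate_pderiv k _ _ _ (hm k List.mem_cons_self), ih hL.2]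
    · simp only [List.map_cons, List.sum_cons, List.prod_cons, Nat.cast_mul, add_assoc]
      ring
    · intro l hl
      have : k ≠ l := fun h => hL.1 (h ▸ hl)
      simp [hm l (List.mem_cons_of_mem _ hl), this]

/-- `α! = α_1! ⋯ α_N!`. -/
def multiFactorial (α : Fin N → ℕ) : ℕ := ∏ k, (α k).factorial

theorem multiFactorial_ne_zero (α : Fin N → ℕ) : (multiFactorial α : ℂ) ≠ 0 := by
  rw [multiFactorial]
  exact_mod_cast Finset.prod_ne_zero_iff.2 fun k _ => (α k).factorial_ne_zero

theorem multiFactorial_add_single (γ : Fin N → ℕ) (i : Fin N) :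
    multiFactorial (γ + Pi.single i 1) = (γ i + 1) * multiFactorial γ := by
  rw [multiFactorial, multiFactorial, ← Finset.mul_prod_erase _ _ (Finset.mem_univ i),
    ← Finset.mul_prod_erase _ (fun k => (γ k).factorial) (Finset.mem_univ i), ← mul_assoc]
  congr 1
  · simp [Nat.factorial_succ]
  · refine Finset.prod_congr rfl fun k hk => ?_
    simp [Finset.ne_of_mem_erase hk]

theorem constantCoeff_multiDeriv (α : Fin N → ℕ) (p : MvPolynomial (Fin N) ℂ) :
    MvPolynomial.coeff 0 (multiDeriv α (List.finRange N) p) =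
      MvPolynomial.coeff (Finsupp.equivFunOnFinite.symm α) p * multiFactorial α := by
  rw [coeff_multiDeriv α _ (List.nodup_finRange N) p 0 (by simp), zero_add]
  have h1 : ((List.finRange N).map fun k => Finsupp.single k (α k)).sum =
      Finsupp.equivFunOnFinite.symm α := by
    rw [← List.ofFn_eq_map, List.sum_ofFn]
    ext k
    simp [Finsupp.finsetSum_apply, Finsupp.single_apply]
  have h2 : ((List.finRange N).map fun k => (α k).factorial).prod = multiFactorial α := by
    rw [← List.ofFn_eq_map, List.prod_ofFn, multiFactorial]
  rw [h1, h2]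

/-- At the centre all shifted moments vanish; together with `constantCoeff_multiDeriv` this makes
iterated D-derivatives read off Taylor coefficients. -/
theorem momentPoly_center (z : Coord N) (p : MvPolynomial (Fin N) ℂ) :
    momentPoly (fun l => moment l z) p z = MvPolynomial.coeff 0 p := by
  simp only [momentPoly, sub_self, MvPolynomial.eval_zero', MvPolynomial.constantCoeff_eq]

theorem conjMomentPoly_center (z : Coord N) (p : MvPolynomial (Fin N) ℂ) :
    conjMomentPoly (fun l => (starRingEnd ℂ) (moment l z)) p z = MvPolynomial.coeff 0 p := by
  simp only [conjMomentPoly, sub_self, MvPolynomial.eval_zero', MvPolynomial.constantCoeff_eq]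

/-! Polynomials in the moment functions are restrictions of functions on `ℂP^N`. -/

/-- The function `Z_a Z̄_b / |Z|²` of the homogeneous coordinates. -/
def projMoment (a b : Fin (N + 1)) : CP N → ℂ :=
  Projectivization.lift (fun v => v.1 a * (starRingEnd ℂ) (v.1 b) /
    ∑ i, v.1 i * (starRingEnd ℂ) (v.1 i)) (by
      rintro ⟨v, hv⟩ ⟨w, hw⟩ t (rfl : v = t • w)
      have ht : t ≠ 0 := fun h => hv (by simp [h])
      have ht' : (starRingEnd ℂ) t ≠ 0 := by simpa using ht
      have h1 : ∑ i, (t • w) i * (starRingEnd ℂ) ((t • w) i) =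
          (t * (starRingEnd ℂ) t) * ∑ i, w i * (starRingEnd ℂ) (w i) := by
        rw [Finset.mul_sum]
        exact Finset.sum_congr rfl fun i _ => by simp; ring
      simp only [h1]
      rw [show (t • w) a * (starRingEnd ℂ) ((t • w) b) =
        (t * (starRingEnd ℂ) t) * (w a * (starRingEnd ℂ) (w b)) by simp; ring,
        mul_div_mul_left _ _ (mul_ne_zero ht ht')])

theorem sum_homog (j : Fin (N + 1)) (z : Coord N) :
    ∑ i, homog j z i * (starRingEnd ℂ) (homog j z i) = normFactor z := by
  rw [Fin.sum_univ_succAbove _ j]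
  simp [homog, normFactor]

theorem projMoment_affine (a b j : Fin (N + 1)) (z : Coord N) :
    projMoment a b (affine j z) =
      homog j z a * (starRingEnd ℂ) (homog j z b) / normFactor z := by
  rw [affine, projMoment, Projectivization.lift_mk, sum_homog]

theorem contDiff_homog (j a : Fin (N + 1)) : ContDiff ℝ ∞ (fun z : Coord N => homog j z a) := by
  rcases Fin.eq_self_or_eq_succAbove j a with rfl | ⟨l, rfl⟩
  · simpa [homog] using contDiff_const
  · simpa [homog] using contDiff_coord l

theorem isSmooth_projMoment (a b : Fin (N + 1)) : IsSmooth (projMoment a b) := by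
  intro j
  have h := ((contDiff_homog j a).mul ((Complex.conjCLE : ℂ →L[ℝ] ℂ).contDiff.comp
    (contDiff_homog j b))).mul (contDiff_normFactor.inv normFactor_ne_zero)
  rwa [show (fun z => projMoment a b (affine j z)) = fun z => homog j z a *
    (starRingEnd ℂ) (homog j z b) * normFactor⁻¹ z from funext fun z => by
      rw [projMoment_affine]; exact div_eq_mul_inv _ _]

theorem projMoment_affine_self (j : Fin (N + 1)) (l : Fin N) (z : Coord N) :
    projMoment (j.succAbove l) j (affine j z) = moment l z := by
  simp [projMoment_affine, homog, moment]

theorem projMoment_affine_self_conj (j : Fin (N + 1)) (l : Fin N) (z : Coord N) :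
    projMoment j (j.succAbove l) (affine j z) = (starRingEnd ℂ) (moment l z) := by
  simp [projMoment_affine, homog, moment, conj_normFactor]

/-- The expansion is assumed only for functions on ℂP^N. In chart `j` the j-th homogeneous
coordinate is 1, so Z_a Z̄_j/|Z|² restricts to a moment. -/
theorem exists_isSmooth_momentPoly (j : Fin (N + 1)) (u : Fin N → ℂ)
    (p : MvPolynomial (Fin N) ℂ) :
    ∃ g : CP N → ℂ, IsSmooth g ∧ (fun z => g (affine j z)) = momentPoly u p :=
  ⟨fun x => MvPolynomial.eval (fun l => projMoment (j.succAbove l) j x - u l) p,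
    fun j' => contDiff_eval (fun _ => (isSmooth_projMoment _ _ j').sub contDiff_const) p,
    by simp only [projMoment_affine_self]; rfl⟩

theorem exists_isSmooth_conjMomentPoly (j : Fin (N + 1)) (v : Fin N → ℂ)
    (q : MvPolynomial (Fin N) ℂ) :
    ∃ f : CP N → ℂ, IsSmooth f ∧ (fun z => f (affine j z)) = conjMomentPoly v q :=
  ⟨fun x => MvPolynomial.eval (fun l => projMoment j (j.succAbove l) x - v l) q,
    fun j' => contDiff_eval (fun _ => (isSmooth_projMoment _ _ j').sub contDiff_const) q,
    by simp only [projMoment_affine_self_conj]; rfl⟩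

/-! Left multiplication operators on polynomials in the moment functions. -/

/-- The exponent vector `α` as a finitely supported function. -/
abbrev expo (α : Fin N → ℕ) : Fin N →₀ ℕ := Finsupp.equivFunOnFinite.symm α

theorem expo_add_single (α : Fin N → ℕ) (d : Fin N) :
    expo α + Finsupp.single d 1 = expo (α + Pi.single d 1) := by
  ext k
  simp [Finsupp.single_apply, Pi.single_apply, eq_comm]

theorem sum_add_single (α : Fin N → ℕ) (d : Fin N) :
    ∑ k, (α + Pi.single d 1 : Fin N → ℕ) k = ∑ k, α k + 1 := by
  simp [Finset.sum_add_distrib]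

theorem coeff_expo_monomial (α β : Fin N → ℕ) :
    MvPolynomial.coeff (expo β) (MvPolynomial.monomial (expo α) (1 : ℂ)) =
      if β = α then 1 else 0 := by
  rw [MvPolynomial.coeff_monomial]
  simp [eq_comm]

/-- The summands X_k ∂_k form the Euler operator, which multiplies by the degree; the summands u_k
∂_k lower the degree and are invisible in degrees at least |γ|. -/
theorem coeff_eulerShift (u : Fin N → ℂ) (γ β : Fin N → ℕ) (h : ∑ k, γ k ≤ ∑ k, β k) :
    MvPolynomial.coeff (expo β) (∑ k, (MvPolynomial.X k + MvPolynomial.C (u k)) *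
      MvPolynomial.pderiv k (MvPolynomial.monomial (expo γ) (1 : ℂ))) =
      ((∑ k, γ k : ℕ) : ℂ) * if β = γ then 1 else 0 := by
  simp only [add_mul, MvPolynomial.X_mul_pderiv_monomial, MvPolynomial.coeff_sum,
    MvPolynomial.coeff_add, MvPolynomial.coeff_C_mul, MvPolynomial.coeff_pderiv,
    MvPolynomial.coeff_smul, expo_add_single, coeff_expo_monomial]
  have h1 : ∀ k, β + Pi.single k 1 ≠ γ := by
    rintro k rfl
    rw [sum_add_single] at h
    omega
  simp [h1, Finset.sum_ite_irrel]

theorem coeff_X_add_C_mul (c : ℂ) (i : Fin N) (β : Fin N → ℕ) (p : MvPolynomial (Fin N) ℂ) :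
    MvPolynomial.coeff (expo β) ((MvPolynomial.X i + MvPolynomial.C c) * p) =
      (if β i = 0 then 0 else MvPolynomial.coeff (expo (β - Pi.single i 1)) p) +
        c * MvPolynomial.coeff (expo β) p := by
  rw [add_mul, MvPolynomial.coeff_add, MvPolynomial.coeff_C_mul, MvPolynomial.coeff_X_mul']
  congr 1
  have : expo β - Finsupp.single i 1 = expo (β - Pi.single i 1) := by
    ext k
    simp [Finsupp.single_apply, Pi.single_apply, eq_comm]
  simp [this]

theorem sub_single_add_single {β : Fin N → ℕ} {i : Fin N} (h : β i ≠ 0) :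
    β - Pi.single i 1 + Pi.single i 1 = β := by
  ext k
  by_cases hk : k = i
  · subst hk
    simp
    omega
  · simp [hk]

theorem coeff_moment_mul_monomial (u : Fin N → ℂ) (i : Fin N) (γ β : Fin N → ℕ)
    (h : ∑ k, β k = ∑ k, γ k + 1) :
    MvPolynomial.coeff (expo β) ((MvPolynomial.X i + MvPolynomial.C (u i)) *
      MvPolynomial.monomial (expo γ) (1 : ℂ)) = if β = γ + Pi.single i 1 then 1 else 0 := by
  have h1 : β ≠ γ := by rintro rfl; omega
  rw [coeff_X_add_C_mul, coeff_expo_monomial, coeff_expo_monomial, if_neg h1, mul_zero, add_zero]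
  by_cases hi : β i = 0
  · rw [if_pos hi, if_neg]
    rintro rfl
    simp at hi
  · rw [if_neg hi]
    refine if_congr ⟨fun h => ?_, fun h => ?_⟩ rfl rfl
    · rw [← h, sub_single_add_single hi]
    · rw [h, add_tsub_cancel_right]

/-- In the top degree |γ|+1 only X_i times the Euler operator contributes, whence the factor -|γ|.
-/
theorem coeff_dzbarPoly_monomial (u : Fin N → ℂ) (i : Fin N) (γ β : Fin N → ℕ)
    (h : ∑ k, β k = ∑ k, γ k + 1) :
    MvPolynomial.coeff (expo β) (dzbarPoly u i (MvPolynomial.monomial (expo γ) (1 : ℂ))) =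
      if β = γ + Pi.single i 1 then -((∑ k, γ k : ℕ) : ℂ) else 0 := by
  have h1 : β ≠ γ := by rintro rfl; omega
  rw [dzbarPoly, MvPolynomial.coeff_neg, coeff_X_add_C_mul,
    coeff_eulerShift u γ β (by omega), if_neg h1, mul_zero, mul_zero, add_zero]
  by_cases hi : β i = 0
  · rw [if_pos hi, if_neg, neg_zero]
    rintro rfl
    simp at hi
  · have h2 : ∑ k, β k = ∑ k, (β - Pi.single i 1 : Fin N → ℕ) k + 1 := by
      rw [← sum_add_single, sub_single_add_single hi]
    rw [if_neg hi, coeff_eulerShift u γ _ (by omega)]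
    have h3 : β - Pi.single i 1 = γ ↔ β = γ + Pi.single i 1 :=
      ⟨fun h => by rw [← h, sub_single_add_single hi], fun h => by rw [h, add_tsub_cancel_right]⟩
    simp only [h3]
    split_ifs <;> simp

theorem constantCoeff_pderiv_multiDeriv (d : Fin N) (α : Fin N → ℕ) (p : MvPolynomial (Fin N) ℂ) :
    MvPolynomial.coeff 0 (MvPolynomial.pderiv d (multiDeriv α (List.finRange N) p)) =
      MvPolynomial.coeff (expo (α + Pi.single d 1)) p * multiFactorial (α + Pi.single d 1) := by
  rw [pderiv_multiDeriv, constantCoeff_multiDeriv, MvPolynomial.coeff_pderiv, expo_add_single,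
    multiFactorial_add_single]
  simp
  ring

theorem constantCoeff_dzbarPoly (u : Fin N → ℂ) (i : Fin N) (p : MvPolynomial (Fin N) ℂ) :
    MvPolynomial.coeff 0 (dzbarPoly u i p) =
      -(u i * ∑ k, u k * MvPolynomial.coeff 0 (MvPolynomial.pderiv k p)) := by
  simp only [← MvPolynomial.constantCoeff_eq, dzbarPoly, map_neg, map_mul, map_add, map_sum,
    MvPolynomial.constantCoeff_X, MvPolynomial.constantCoeff_C, zero_add]

/-! ### Formal operators applied to test polynomials. -/

/-- The value of the formal differential operator with coefficients `a` on the polynomial `p` in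
the moment functions. -/
def opValue (a : ℕ → ((Fin N → ℕ) →₀ (Coord N → ℂ))) (u : Fin N → ℂ)
    (p : MvPolynomial (Fin N) ℂ) (z : Coord N) : ℂ⟦X⟧ :=
  PowerSeries.mk fun s => (a s).sum fun β c =>
    c z * momentPoly u (multiDeriv β (List.finRange N) p) z

theorem multiDeriv_zero (α : Fin N → ℕ) (L : List (Fin N)) : multiDeriv α L 0 = 0 := by
  induction L with
  | nil => rfl
  | cons k L ih =>
    rw [multiDeriv, List.foldr_cons, ← multiDeriv, ih]
    exact Function.iterate_fixed (map_zero _) _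

theorem opValue_zero (a : ℕ → ((Fin N → ℕ) →₀ (Coord N → ℂ))) (u : Fin N → ℂ) (z : Coord N) :
    opValue a u 0 z = 0 := by
  ext s
  simp [opValue, multiDeriv_zero, momentPoly, Finsupp.sum]

theorem coeff_formalOp (a : ℕ → ((Fin N → ℕ) →₀ (Coord N → ℂ))) (u : Fin N → ℂ)
    (G : Coord N → ℂ⟦X⟧) (P : ℕ → MvPolynomial (Fin N) ℂ)
    (hG : ∀ t, (fun w => PowerSeries.coeff t (G w)) = momentPoly u (P t)) (z : Coord N) (k : ℕ) :
    PowerSeries.coeff k (formalOp a G z) =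
      ∑ x ∈ Finset.HasAntidiagonal.antidiagonal k,
        PowerSeries.coeff x.1 (opValue a u (P x.2) z) := by
  simp only [formalOp, PowerSeries.coeff_mk, hG, DbarPow_momentPoly, opValue]

theorem momentPoly_zero (u : Fin N → ℂ) : momentPoly u 0 = fun _ => 0 := by
  funext z
  simp [momentPoly]

theorem coeff_C_momentPoly (u : Fin N → ℂ) (p : MvPolynomial (Fin N) ℂ) (t : ℕ) :
    (fun w => PowerSeries.coeff t (PowerSeries.C (momentPoly u p w))) =
      momentPoly u (if t = 0 then p else 0) := by
  funext w
  rw [PowerSeries.coeff_C]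
  split_ifs <;> simp [momentPoly_zero]

theorem formalOp_momentPoly (a : ℕ → ((Fin N → ℕ) →₀ (Coord N → ℂ))) (u : Fin N → ℂ)
    (p : MvPolynomial (Fin N) ℂ) (z : Coord N) :
    formalOp a (fun w => PowerSeries.C (momentPoly u p w)) z = opValue a u p z := by
  ext k
  rw [coeff_formalOp a u _ _ (coeff_C_momentPoly u p), Finset.sum_eq_single (k, 0)]
  · simp
  · rintro ⟨s, t⟩ hst hne
    have ht : t ≠ 0 := by
      rintro rfl
      rw [Finset.HasAntidiagonal.mem_antidiagonal] at hst
      exact hne (by simpa using hst)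
    simp [ht, opValue_zero]
  · simp

theorem coeff_rightOp_momentPoly (i : Fin N) (u : Fin N → ℂ) (p : MvPolynomial (Fin N) ℂ) (t : ℕ) :
    (fun w => PowerSeries.coeff t
      (rightOp i (fun w => PowerSeries.C (momentPoly u p w)) w)) =
      momentPoly u (if t = 0 then (MvPolynomial.X i + MvPolynomial.C (u i)) * p else
        if t = 1 then dzbarPoly u i p else 0) := by
  funext w
  rw [rightOp, map_add, ← map_mul, dzbar_potential_eq_moment, moment_mul_momentPoly,
    PowerSeries.coeff_C]
  rcases t with _ | t
  · simp
  · rw [PowerSeries.coeff_succ_X_mul, PowerSeries.coeff_mk, coeff_C_momentPoly, dzbar_momentPoly]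
    rcases t with _ | t
    · simp
    · simp [dzbarPoly, momentPoly]

theorem formalOp_rightOp_momentPoly (a : ℕ → ((Fin N → ℕ) →₀ (Coord N → ℂ))) (i : Fin N)
    (u : Fin N → ℂ) (p : MvPolynomial (Fin N) ℂ) (z : Coord N) :
    formalOp a (rightOp i (fun w => PowerSeries.C (momentPoly u p w))) z =
      opValue a u ((MvPolynomial.X i + MvPolynomial.C (u i)) * p) z +
        PowerSeries.X * opValue a u (dzbarPoly u i p) z := by
  ext k
  rw [coeff_formalOp a u _ _ (coeff_rightOp_momentPoly i u p), map_add]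
  rcases k with _ | k
  · simp
  -- The split-off term is the ħ^0 part of the argument; in the remaining sum the second index is
  -- shifted by one, so only its value 0, the ħ^1 part, survives.
  · rw [Finset.Nat.sum_antidiagonal_succ', PowerSeries.coeff_succ_X_mul]
    congr 1
    rw [Finset.sum_eq_single (k, 0)]
    · simp
    · rintro ⟨s, t⟩ hst hne
      have ht : t ≠ 0 := by
        rintro rfl
        rw [Finset.HasAntidiagonal.mem_antidiagonal] at hst
        exact hne (by simpa using hst)
      simp [ht, opValue_zero]
    · simp

theorem isFormalSmooth_const {f : CP N → ℂ} (hf : IsSmooth f) : IsFormalSmooth (const f) := by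
  intro k j
  simp only [const, PowerSeries.coeff_C]
  split_ifs
  · exact hf j
  · exact contDiff_const

theorem isFormalSmoothCoord_momentPoly (u : Fin N → ℂ) (p : MvPolynomial (Fin N) ℂ) :
    IsFormalSmoothCoord (fun w => PowerSeries.C (momentPoly u p w)) := fun k => by
  rw [coeff_C_momentPoly]
  exact contDiff_momentPoly _ _

/-! The recursion. -/

section
variable {star : (CP N → ℂ⟦X⟧) → (CP N → ℂ⟦X⟧) → (CP N → ℂ⟦X⟧)} {j : Fin (N + 1)}
  {T : ℕ → (Fin N → ℤ) → (Fin N → ℤ) → Coord N → ℂ⟦X⟧}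
  {a : ℕ → ((Fin N → ℕ) →₀ (Coord N → ℂ))} {u : Fin N → ℂ}

/-- The natural-number exponent `α`, with integer entries. -/
abbrev toInt (α : Fin N → ℕ) : Fin N → ℤ := fun i => (α i : ℤ)

/-- The operator with coefficients `a` is given, on polynomials in the moment functions, by the
expansion with coefficients `T`, for left multiplication by `conjMomentPoly v q`. -/
def IsExpandedBy (a : ℕ → ((Fin N → ℕ) →₀ (Coord N → ℂ)))
    (T : ℕ → (Fin N → ℤ) → (Fin N → ℤ) → Coord N → ℂ⟦X⟧) (u v : Fin N → ℂ)
    (q : MvPolynomial (Fin N) ℂ) : Prop :=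
  ∀ k : ℕ, ∃ M : ℕ, (∀ n, M ≤ n → ∀ α β z, PowerSeries.coeff k (T n α β z) = 0) ∧
    ∀ (p : MvPolynomial (Fin N) ℂ) (z : Coord N),
      PowerSeries.coeff k (opValue a u p z) =
        ∑ n ∈ Finset.range M,
          ∑ α ∈ Finset.piAntidiag (Finset.univ : Finset (Fin N)) n,
            ∑ β ∈ Finset.piAntidiag (Finset.univ : Finset (Fin N)) n,
              PowerSeries.coeff k (T n (toInt α) (toInt β) z) *
                conjMomentPoly v (multiDeriv α (List.finRange N) q) z *
                momentPoly u (multiDeriv β (List.finRange N) p) z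

/-- The bound `M` precedes the polynomial and the point, so the expansion is a finite sum near every
point and can be differentiated termwise. -/
theorem exists_isExpandedBy (hstar : IsKarabegovStar star) (hT : HasExpansion star j T)
    (u v : Fin N → ℂ) (q : MvPolynomial (Fin N) ℂ) :
    ∃ a : ℕ → ((Fin N → ℕ) →₀ (Coord N → ℂ)), IsExpandedBy a T u v q ∧
      ∀ l : Fin N, ∀ F : Coord N → ℂ⟦X⟧, IsFormalSmoothCoord F →
        formalOp a (rightOp l F) = rightOp l (formalOp a F) := by
  obtain ⟨f, hf, hfq⟩ := exists_isSmooth_conjMomentPoly j v q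
  obtain ⟨a, -, ha, hcomm⟩ := hstar.local_op (const f) (isFormalSmooth_const hf) j
  refine ⟨a, fun k => ?_, hcomm⟩
  obtain ⟨M, hM, hexp⟩ := hT.expansion k
  refine ⟨M, hM, fun p z => ?_⟩
  obtain ⟨g, hg, hgp⟩ := exists_isSmooth_momentPoly j u p
  have h1 := hexp f g hf hg z
  rw [ha _ (isFormalSmooth_const hg), hfq, hgp] at h1
  have h2 : (fun w => const g (affine j w)) = fun w => PowerSeries.C (momentPoly u p w) := by
    rw [← hgp]; rfl
  simpa only [h2, formalOp_momentPoly, DholPow_conjMomentPoly, DbarPow_momentPoly] using h1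

theorem mem_piAntidiag_univ {α : Fin N → ℕ} {n : ℕ} :
    α ∈ Finset.piAntidiag (Finset.univ : Finset (Fin N)) n ↔ ∑ k, α k = n := by
  simp

/-- At the centre the factor from the monomial of exponent α vanishes unless α' = α. This forces
degree n, so the other coefficients of `p` are irrelevant. -/
theorem opValue_center {α β : Fin N → ℕ} {n : ℕ} (hα : ∑ k, α k = n) (hβ : ∑ k, β k = n)
    {z : Coord N}
    (ha : IsExpandedBy a T u (fun l => (starRingEnd ℂ) (moment l z))
      (MvPolynomial.monomial (expo α) 1)) (hu : u = fun l => moment l z)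
    {p : MvPolynomial (Fin N) ℂ} {c : ℂ}
    (hp : ∀ β', ∑ k, β' k = n → MvPolynomial.coeff (expo β') p = if β' = β then c else 0) :
    opValue a u p z =
      PowerSeries.C (multiFactorial α * multiFactorial β * c) * T n (toInt α) (toInt β) z := by
  ext k
  obtain ⟨M, hM, h⟩ := ha k
  subst hu
  rw [h p z, PowerSeries.coeff_C_mul]
  simp only [conjMomentPoly_center, momentPoly_center, constantCoeff_multiDeriv,
    coeff_expo_monomial]
  rw [Finset.sum_eq_single n, Finset.sum_eq_single α, Finset.sum_eq_single β]
  · rw [hp β hβ]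
    simp
    ring
  · intro β' hβ' hne
    rw [hp β' (mem_piAntidiag_univ.1 hβ'), if_neg hne]
    simp
  · exact fun h => absurd (mem_piAntidiag_univ.2 hβ) h
  · intro α' _ hne
    simp [hne]
  · exact fun h => absurd (mem_piAntidiag_univ.2 hα) h
  · intro m _ hm
    refine Finset.sum_eq_zero fun α' hα' => Finset.sum_eq_zero fun β' _ => ?_
    have : α' ≠ α := by
      rintro rfl
      exact hm ((mem_piAntidiag_univ.1 hα').symm.trans hα)
    simp [this]
  · intro hn
    rw [Finset.mem_range, not_lt] at hn
    simp [hM n hn]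

/-- The Leibniz rule, grouped so that the terms where `A` is not differentiated share the factor `A
x z`; in the application that group vanishes. -/
theorem dzbar_sum_mul_mul {ι : Type*} (s : Finset ι) (t A B : ι → Coord N → ℂ) (z : Coord N)
    (i : Fin N) (ht : ∀ x ∈ s, DifferentiableAt ℝ (t x) z)
    (hA : ∀ x ∈ s, DifferentiableAt ℝ (A x) z) (hB : ∀ x ∈ s, DifferentiableAt ℝ (B x) z) :
    dzbar i (fun w => ∑ x ∈ s, t x w * A x w * B x w) z =
      ∑ x ∈ s, (t x z * dzbar i (A x) z * B x z +
        (dzbar i (t x) z * B x z + t x z * dzbar i (B x) z) * A x z) := by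
  rw [dzbar_eq_wirtinger, fderiv_fun_sum (A := fun x w => t x w * A x w * B x w)
    (fun x hx => ((ht x hx).mul (hA x hx)).mul (hB x hx)), map_sum]
  refine Finset.sum_congr rfl fun x hx => ?_
  rw [fderiv_fun_mul ((ht x hx).fun_mul (hA x hx)) (hB x hx), fderiv_fun_mul (ht x hx) (hA x hx)]
  simp only [map_add, map_smul, smul_eq_mul, dzbar_eq_wirtinger, smul_add]
  ring

theorem coeff_expo_ne {α β : Fin N → ℕ} (h : ∑ k, β k ≠ ∑ k, α k) :
    MvPolynomial.coeff (expo β) (MvPolynomial.monomial (expo α) (1 : ℂ)) = 0 := by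
  rw [coeff_expo_monomial, if_neg]
  rintro rfl
  exact h rfl

theorem toInt_sub_single {α : Fin N → ℕ} (d : Fin N) :
    toInt (α + Pi.single d 1) - Pi.single d 1 = toInt α := by
  ext k
  by_cases hk : k = d
  · subst hk; simp [toInt]
  · simp [toInt, hk]

/-- The sum has the single term α' = α - e_d; if α_d = 0 there is none, matching the convention that
`T` vanishes at negative exponents. -/
theorem sum_piAntidiag_add_single (hT : ∀ n α β, ¬ (0 ≤ α ∧ 0 ≤ β) → T n α β = 0)
    {α : Fin N → ℕ} {r : ℕ} (hα : ∑ k, α k = r + 1) (γ : Fin N → ℤ) (d : Fin N) (z : Coord N)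
    (k : ℕ) :
    ∑ α' ∈ Finset.piAntidiag (Finset.univ : Finset (Fin N)) r,
      PowerSeries.coeff k (T r (toInt α') γ z) *
        (if α' + Pi.single d 1 = α then (1 : ℂ) else 0) =
      PowerSeries.coeff k (T r (toInt α - Pi.single d 1) γ z) := by
  by_cases hd : α d = 0
  · rw [hT r (toInt α - Pi.single d 1) γ, Finset.sum_eq_zero]
    · simp
    · intro α' _
      rw [if_neg, mul_zero]
      rintro rfl
      simp at hd
    · rintro ⟨h, -⟩
      have := h d
      simp [hd] at this
  · have h1 := sub_single_add_single hd
    set δ : Fin N → ℕ := α - Pi.single d 1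
    rw [Finset.sum_eq_single δ, if_pos h1, mul_one, ← h1, toInt_sub_single]
    · intro α' _ hne
      rw [if_neg, mul_zero]
      intro h
      exact hne (add_right_cancel (h.trans h1.symm))
    · intro h
      refine absurd (mem_piAntidiag_univ.2 ?_) h
      have := sum_add_single δ d
      rw [h1] at this
      omega

/-- One derivative is missing for f to survive at the centre, since α' must equal α - e_d; the outer
∂_{ī} supplies it and brings the factor g_{dī}. -/
theorem dzbar_opValue_center (hT : HasExpansion star j T) {α γ : Fin N → ℕ} {r : ℕ}
    (hα : ∑ k, α k = r + 1) (hγ : ∑ k, γ k = r) {z : Coord N}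
    (ha : IsExpandedBy a T u (fun l => (starRingEnd ℂ) (moment l z))
      (MvPolynomial.monomial (expo α) 1)) (hu : u = fun l => moment l z) (i : Fin N) (k : ℕ) :
    dzbar i (fun w => PowerSeries.coeff k
      (opValue a u (MvPolynomial.monomial (expo γ) 1) w)) z =
      multiFactorial α * multiFactorial γ *
        ∑ d, metric z d i * PowerSeries.coeff k (T r (toInt α - Pi.single d 1) (toInt γ) z) := by
  obtain ⟨M, hM, h⟩ := ha k
  subst hu
  have hterm : ∀ n, ∀ α' ∈ Finset.piAntidiag (Finset.univ : Finset (Fin N)) n,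
      ∀ β' ∈ Finset.piAntidiag (Finset.univ : Finset (Fin N)) n,
      PowerSeries.coeff k (T n (toInt α') (toInt β') z) *
        dzbar i (conjMomentPoly (fun l => (starRingEnd ℂ) (moment l z))
          (multiDeriv α' (List.finRange N) (MvPolynomial.monomial (expo α) 1))) z *
        momentPoly (fun l => moment l z) (multiDeriv β' (List.finRange N)
          (MvPolynomial.monomial (expo γ) 1)) z +
      (dzbar i (fun w => PowerSeries.coeff k (T n (toInt α') (toInt β') w)) z *
        momentPoly (fun l => moment l z) (multiDeriv β' (List.finRange N)
          (MvPolynomial.monomial (expo γ) 1)) z +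
        PowerSeries.coeff k (T n (toInt α') (toInt β') z) *
          dzbar i (momentPoly (fun l => moment l z) (multiDeriv β' (List.finRange N)
            (MvPolynomial.monomial (expo γ) 1))) z) *
        conjMomentPoly (fun l => (starRingEnd ℂ) (moment l z))
          (multiDeriv α' (List.finRange N) (MvPolynomial.monomial (expo α) 1)) z =
      if β' = γ then ∑ d, multiFactorial α * multiFactorial γ * metric z d i *
        (PowerSeries.coeff k (T n (toInt α') (toInt γ) z) *
          (if α' + Pi.single d 1 = α then (1 : ℂ) else 0)) else 0 := by
    intro n α' hα' β' hβ'
    rw [mem_piAntidiag_univ] at hα' hβ'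
    simp only [dzbar_conjMomentPoly, dzbar_momentPoly, conjMomentPoly_center, momentPoly_center,
      constantCoeff_dzbarPoly, constantCoeff_pderiv_multiDeriv, constantCoeff_multiDeriv]
    -- Terms with f undifferentiated by ∂_{ī} vanish: for n = r+1 the factors from g, of degree r,
    -- are zero, and for any other n the factor from f is.
    have h0 : (dzbar i (fun w => PowerSeries.coeff k (T n (toInt α') (toInt β') w)) z *
        (MvPolynomial.coeff (expo β') (MvPolynomial.monomial (expo γ) 1) * multiFactorial β') +
        PowerSeries.coeff k (T n (toInt α') (toInt β') z) *
          -(moment i z * ∑ l, moment l z *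
            (MvPolynomial.coeff (expo (β' + Pi.single l 1))
              (MvPolynomial.monomial (expo γ) 1) * multiFactorial (β' + Pi.single l 1)))) *
        (MvPolynomial.coeff (expo α') (MvPolynomial.monomial (expo α) 1) *
          multiFactorial α') = 0 := by
      by_cases hn : n = r + 1
      · rw [coeff_expo_ne (by omega : ∑ l, β' l ≠ ∑ l, γ l)]
        have : ∀ l, MvPolynomial.coeff (expo (β' + Pi.single l 1))
            (MvPolynomial.monomial (expo γ) (1 : ℂ)) = 0 := fun l =>
          coeff_expo_ne (by rw [sum_add_single]; omega)
        simp [this]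
      · rw [coeff_expo_ne (by omega : ∑ l, α' l ≠ ∑ l, α l)]
        simp
    rw [h0, add_zero, coeff_expo_monomial]
    split_ifs with hβγ
    · subst hβγ
      rw [Finset.mul_sum, Finset.sum_mul]
      refine Finset.sum_congr rfl fun d _ => ?_
      rw [coeff_expo_monomial]
      split_ifs with hd
      · rw [hd]; ring
      · ring
    · ring
  simp only [h]
  -- The triple sum is flattened so that the Leibniz rule applies once.
  simp only [Finset.sum_sigma' (Finset.range M), Finset.sum_sigma' (Finset.sigma _ _)]
  rw [dzbar_sum_mul_mul]
  · rw [Finset.sum_sigma, Finset.sum_sigma]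
    rw [Finset.sum_congr rfl fun n _ => Finset.sum_congr rfl fun α' hα' =>
      Finset.sum_congr rfl fun β' hβ' => hterm n α' hα' β' hβ']
    rw [Finset.sum_eq_single r]
    · simp only [Finset.sum_ite_eq', mem_piAntidiag_univ, hγ, if_true]
      rw [Finset.sum_comm, Finset.mul_sum]
      refine Finset.sum_congr rfl fun d _ => ?_
      rw [← Finset.mul_sum, sum_piAntidiag_add_single hT.eq_zero hα, mul_assoc]
    · intro n _ hn
      refine Finset.sum_eq_zero fun α' _ => Finset.sum_eq_zero fun β' hβ' => if_neg ?_
      rintro rfl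
      exact hn ((mem_piAntidiag_univ.1 hβ').symm.trans hγ)
    · intro hr
      rw [Finset.mem_range, not_lt] at hr
      simp [hM r hr]
  · exact fun x _ => (hT.smooth _ _ _ k).differentiable (by simp) z
  · exact fun x _ => (contDiff_conjMomentPoly _ _).differentiable (by simp) z
  · exact fun x _ => (contDiff_momentPoly _ _).differentiable (by simp) z

/-- The commutation relation applied to the monomial of exponent γ and evaluated at its centre `z`.
-/
theorem recursion_nat (hstar : IsKarabegovStar star) (hT : HasExpansion star j T)
    {α γ : Fin N → ℕ} {r : ℕ} (hα : ∑ k, α k = r + 1) (hγ : ∑ k, γ k = r) (i : Fin N)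
    (z : Coord N) :
    ((1 - PowerSeries.X * (r : ℂ⟦X⟧)) * ((γ i + 1 : ℕ) : ℂ⟦X⟧)) *
        T (r + 1) (toInt α) (toInt (γ + Pi.single i 1)) z =
      ∑ d, PowerSeries.X * PowerSeries.C (metric z d i) *
        T r (toInt α - Pi.single d 1) (toInt γ) z := by
  obtain ⟨a, ha, hcomm⟩ := exists_isExpandedBy hstar hT (fun l => moment l z)
    (fun l => (starRingEnd ℂ) (moment l z)) (MvPolynomial.monomial (expo α) 1)
  have hβ : ∑ k, (γ + Pi.single i 1 : Fin N → ℕ) k = r + 1 := by rw [sum_add_single, hγ]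
  have h := congrFun (hcomm i _ (isFormalSmoothCoord_momentPoly (fun l => moment l z)
    (MvPolynomial.monomial (expo γ) 1))) z
  rw [formalOp_rightOp_momentPoly,
    opValue_center hα hβ ha rfl (c := 1)
      (p := (MvPolynomial.X i + MvPolynomial.C (moment i z)) * MvPolynomial.monomial (expo γ) 1)
      (fun β' hβ' => coeff_moment_mul_monomial (fun l => moment l z) i γ β' (by omega)),
    opValue_center hα hβ ha rfl
      (fun β' hβ' => coeff_dzbarPoly_monomial _ i γ β' (by omega)), hγ] at h
  -- A monomial of degree r has no coefficients of degree r+1, so the multiplication term of the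
  -- right-hand operator drops out.
  have h0 : opValue a (fun l => moment l z) (MvPolynomial.monomial (expo γ) 1) z = 0 := by
    rw [opValue_center hα hβ ha rfl (c := 0), mul_zero, map_zero, zero_mul]
    intro β' hβ'
    rw [coeff_expo_ne (by omega), ite_self]
  have h1 : (PowerSeries.mk fun k => dzbar i (fun w => PowerSeries.coeff k
      (formalOp a (fun w => PowerSeries.C
        (momentPoly (fun l => moment l z) (MvPolynomial.monomial (expo γ) 1) w)) w)) z) =
      PowerSeries.C (multiFactorial α * multiFactorial γ : ℂ) *
        ∑ d, PowerSeries.C (metric z d i) * T r (toInt α - Pi.single d 1) (toInt γ) z := by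
    ext k
    simp only [formalOp_momentPoly, PowerSeries.coeff_mk, PowerSeries.coeff_C_mul, map_sum]
    exact dzbar_opValue_center hT hα hγ ha rfl i k
  rw [rightOp, h1, formalOp_momentPoly, h0, mul_zero, zero_add,
    multiFactorial_add_single] at h
  -- The factor α!γ! is common to both sides; (γ+e_i)! = (γ_i+1)γ! leaves γ_i+1.
  have hne : (PowerSeries.C (multiFactorial α * multiFactorial γ : ℂ) : ℂ⟦X⟧) ≠ 0 := by
    rw [map_ne_zero_iff _ PowerSeries.C_injective]
    exact mul_ne_zero (multiFactorial_ne_zero α) (multiFactorial_ne_zero γ)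
  refine mul_left_cancel₀ hne ?_
  simp only [mul_assoc PowerSeries.X, ← Finset.mul_sum]
  rw [mul_left_comm _ PowerSeries.X, ← h]
  push_cast
  simp only [map_mul, map_add, map_neg, map_natCast, map_one]
  ring

end

theorem recursion_of_sum_eq {star : (CP N → ℂ⟦X⟧) → (CP N → ℂ⟦X⟧) → (CP N → ℂ⟦X⟧)}
    {j : Fin (N + 1)} {T : ℕ → (Fin N → ℤ) → (Fin N → ℤ) → Coord N → ℂ⟦X⟧}
    (hstar : IsKarabegovStar star) (hT : HasExpansion star j T)
    {r : ℕ} {α β : Fin N → ℤ} (hα : ∑ k, α k = r + 1) (hβ : ∑ k, β k = r + 1) (i : Fin N)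
    (hi : β i ≠ 0) (z : Coord N) :
    ((1 - PowerSeries.X * (r : ℂ⟦X⟧)) * (β i : ℂ⟦X⟧)) * T (r + 1) α β z =
      ∑ d, PowerSeries.X * PowerSeries.C (metric z d i) *
        T r (α - Pi.single d 1) (β - Pi.single i 1) z := by
  by_cases h : 0 ≤ α ∧ 0 ≤ β
  · obtain ⟨h1, h2⟩ := h
    lift α to Fin N → ℕ using h1
    lift β to Fin N → ℕ using h2
    have hi' : β i ≠ 0 := by simpa using hi
    obtain ⟨γ, rfl⟩ : ∃ γ : Fin N → ℕ, β = γ + Pi.single i 1 :=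
      ⟨_, (sub_single_add_single hi').symm⟩
    have h3 : ∑ k, α k = r + 1 := Nat.cast_injective (R := ℤ) (by push_cast; exact hα)
    have h4 : ∑ k, (γ + Pi.single i 1 : Fin N → ℕ) k = r + 1 :=
      Nat.cast_injective (R := ℤ) (by rw [Nat.cast_sum]; push_cast; exact hβ)
    rw [sum_add_single] at h4
    have h5 := recursion_nat hstar hT h3 (by omega : ∑ k, γ k = r) i z
    rw [← toInt_sub_single (α := γ) i] at h5
    have h6 : ((toInt (γ + Pi.single i 1) i : ℤ) : ℂ⟦X⟧) = ((γ i + 1 : ℕ) : ℂ⟦X⟧) := by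
      simp [toInt]
    rw [← h6] at h5
    exact h5
  -- A negative entry of α or β persists after subtracting a basis vector, so both sides are zero.
  · rw [hT.eq_zero _ _ _ h, Pi.zero_apply, mul_zero, eq_comm]
    refine Finset.sum_eq_zero fun d _ => ?_
    rw [hT.eq_zero, Pi.zero_apply, mul_zero]
    rintro ⟨h1, h2⟩
    refine h ⟨fun k => ?_, fun k => ?_⟩
    · have := h1 k
      by_cases hk : k = d
      · subst hk; simp at this ⊢; omega
      · simpa [hk] using this
    · have := h2 k
      by_cases hk : k = i
      · subst hk; simp at this ⊢; omega
      · simpa [hk] using this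

end KahlerStar

end

theorem mainTheorem5 (N : ℕ)
    (star : (KahlerStar.CP N → ℂ⟦X⟧) → (KahlerStar.CP N → ℂ⟦X⟧) → (KahlerStar.CP N → ℂ⟦X⟧))
    (hstar : KahlerStar.IsKarabegovStar star)
    (j : Fin (N + 1))
    (T : ℕ → (Fin N → ℤ) → (Fin N → ℤ) → KahlerStar.Coord N → ℂ⟦X⟧)
    (hT : KahlerStar.HasExpansion star j T)
    (n : ℕ) (hn : 1 ≤ n) (α β : Fin N → ℤ) (hα : ∑ k, α k = n) (hβ : ∑ k, β k = n)
    (i : Fin N) (hi : β i ≠ 0) (z : KahlerStar.Coord N) :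
    T n α β z =
      ∑ d : Fin N,
        (PowerSeries.X * PowerSeries.C (KahlerStar.metric z d i)) *
          ((1 + PowerSeries.X - PowerSeries.X * (n : ℂ⟦X⟧)) * (β i : ℂ⟦X⟧))⁻¹ *
          T (n - 1) (α - Pi.single d 1) (β - Pi.single i 1) z := by
  obtain ⟨r, rfl⟩ : ∃ r, n = r + 1 := ⟨n - 1, by omega⟩
  have h := KahlerStar.recursion_of_sum_eq hstar hT (by exact_mod_cast hα)
    (by exact_mod_cast hβ) i hi z
  -- With n = r+1, 1 + ħ - ħn = 1 - ħr.
  have hden : (1 + PowerSeries.X - PowerSeries.X * ((r + 1 : ℕ) : ℂ⟦X⟧)) * (β i : ℂ⟦X⟧) =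
      (1 - PowerSeries.X * (r : ℂ⟦X⟧)) * (β i : ℂ⟦X⟧) := by
    push_cast; ring
  -- The constant term is β_i ≠ 0, so the power series inverse is genuine.
  have hc : PowerSeries.constantCoeff ((1 - PowerSeries.X * (r : ℂ⟦X⟧)) * (β i : ℂ⟦X⟧)) ≠ 0 := by
    simpa using hi
  rw [hden, Nat.add_sub_cancel]
  simp only [mul_right_comm _ (_⁻¹ : ℂ⟦X⟧), ← Finset.sum_mul]
  rw [← h, mul_right_comm, PowerSeries.mul_inv_cancel _ hc, one_mul]
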